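/- Let $\Omega\subset\mathbb{R}^d$ be a bounded domain, $V:=H^1_0(\Omega)\times H^1_0(\Omega)$ and $H:=L^2(\Omega)\times L^2(\Omega)$, with the scalar products $(u,v)_V:=\sum_{i=1}^2\int_\Omega\nabla u_i\cdot\nabla v_i\,dx$ and $(h,g)_H:=\sum_{i=1}^2\int_\Omega h_ig_i\,dx$, and let $c_{VH}$ be the smallest constant with $\|u\|_H\le c_{VH}\|u\|_V$ for all $u\in V$. Let $l<1/c_{VH}^2$ be real, equip $V$ with the scalar product $(u,v)_W:=(u,v)_V-l\,(u,v)_H$, and let $J_W:V^*\to V$ be the isomorphism given by $(J_W\phi,v)_W=\langle\phi,v\rangle$ for all $v\in V$, where $H\subset V^*$ via $\langle h,v\rangle=(h,v)_H$. Let $f$ map $\Omega\times\mathbb{R}^2$ into the nonempty compact convex subsets of $\mathbb{R}^2$ such that $x\mapsto f(x,s)$ is measurable for every $s\in\mathbb{R}^2$, $s\mapsto f(x,s)$ is continuous (in the Hausdorff metric) for almost every $x\in\Omega$, and there are $\alpha\in L^2(\Omega)$ and $\beta\ge 0$ with $\sup_{y\in f(x,s)}\|y\|_2\le\alpha(x)+\beta\|s\|_2$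 for almost every $x\in\Omega$ and all $s\in\mathbb{R}^2$. For $u\in H$ put $N_f(u):=\{h\in H: h(x)\in f(x,u(x))\text{ for a.e. }x\in\Omega\}$. Then for all $u,v\in V$ the set $N_f(u)$ is nonempty, the values $(w,v)_W$, $w\in J_WN_f(u)$, are bounded above, the function $x\mapsto\sigma(v(x),f(x,u(x)))$ is integrable on $\Omega$, and $$\sigma_W(v,J_WN_f(u))=\int_\Omega\sigma(v(x),f(x,u(x)))\,dx,$$ where $\sigma_W(v,A):=\sup_{w\in A}(w,v)_W$ for $A\subset V$ and $\sigma(p,B):=\sup_{y\in B}\langle y,p\rangle$ for $p\in\mathbb{R}^2$, $B\subset\mathbb{R}^2$. -/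

import Mathlib

open MeasureTheory
open scoped ContDiff

noncomputable section

namespace EllipticInclusion

/-- Euclidean space `ℝⁿ`. -/
abbrev Euc (n : ℕ) := EuclideanSpace ℝ (Fin n)

variable {d : ℕ}

/-! ### The function spaces -/

/-- Lebesgue measure on `Ω`. -/
abbrev vol (Ω : Set (Euc d)) : Measure (Euc d) := volume.restrict Ω

/-- `L²(Ω)`. -/
abbrev L2 (Ω : Set (Euc d)) := Lp ℝ 2 (vol Ω)

/-- `L²(Ω; ℝᵈ)`, where weak gradients live. -/
abbrev L2Vec (Ω : Set (Euc d)) := Lp (Euc d) 2 (vol Ω)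

/-- The pairs `(w, ∇w)` with `w ∈ C_c^∞(Ω)`, in `L²(Ω) × L²(Ω; ℝᵈ)` with the norm
`(‖w‖² + ‖∇w‖²)^{1/2}`, which is the `H¹` norm of `w`. -/
def testGraph (Ω : Set (Euc d)) : Set (WithLp 2 (L2 Ω × L2Vec Ω)) :=
  {p | ∃ φ : Euc d → ℝ, ContDiff ℝ ∞ φ ∧ HasCompactSupport φ ∧ tsupport φ ⊆ Ω ∧
    (p.fst : Euc d → ℝ) =ᵐ[vol Ω] φ ∧ (p.snd : Euc d → Euc d) =ᵐ[vol Ω] gradient φ}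

/-- `H¹₀(Ω)`: the closure of `C_c^∞(Ω)` in the `H¹` norm. A function `w ∈ H¹₀(Ω)` is represented by
the pair `(w, ∇w)` of the function and its weak gradient. -/
def H10 (Ω : Set (Euc d)) : Submodule ℝ (WithLp 2 (L2 Ω × L2Vec Ω)) :=
  (Submodule.span ℝ (testGraph Ω)).topologicalClosure

instance (Ω : Set (Euc d)) : CompleteSpace (H10 Ω) :=
  (Submodule.isClosed_topologicalClosure _).completeSpace_coe

variable {Ω : Set (Euc d)}

/-- The `L²` function underlying `w ∈ H¹₀(Ω)`. -/
def H10.fn : H10 Ω →L[ℝ] L2 Ω := (WithLp.fstL 2 ℝ (L2 Ω) (L2Vec Ω)).comp (H10 Ω).subtypeL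

/-- The weak gradient of `w ∈ H¹₀(Ω)`. -/
def H10.grad : H10 Ω →L[ℝ] L2Vec Ω := (WithLp.sndL 2 ℝ (L2 Ω) (L2Vec Ω)).comp (H10 Ω).subtypeL

/-- `V = H¹₀(Ω) × H¹₀(Ω)`. As a topological vector space it carries the product `H¹` norm; the
scalar product used on it is `innerV` below, which on a bounded domain induces an equivalent norm.
Hence `V* = H⁻¹(Ω) × H⁻¹(Ω)` is `StrongDual ℝ (V Ω)`. -/
abbrev V (Ω : Set (Euc d)) := WithLp 2 (H10 Ω × H10 Ω)

/-- `H = L²(Ω) × L²(Ω)` with `(h, g)_H = (h₁, g₁)_{L²} + (h₂, g₂)_{L²}`. -/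
abbrev H (Ω : Set (Euc d)) := WithLp 2 (L2 Ω × L2 Ω)

/-- The point value `(h₁(x), h₂(x)) ∈ ℝ²` of `h ∈ H`. -/
def H.val (h : H Ω) (x : Euc d) : Euc 2 := !₂[h.fst x, h.snd x]

/-- The embedding `i : V → H`. -/
def embH : V Ω →L[ℝ] H Ω :=
  (WithLp.prodContinuousLinearEquiv 2 ℝ (L2 Ω) (L2 Ω)).symm.toContinuousLinearMap.comp
    ((H10.fn.comp (WithLp.fstL 2 ℝ (H10 Ω) (H10 Ω))).prod
      (H10.fn.comp (WithLp.sndL 2 ℝ (H10 Ω) (H10 Ω))))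

/-- The dual embedding `i* : H → V*`, `⟨i* h, v⟩ = (h, v)_H`. -/
def embDual (h : H Ω) : StrongDual ℝ (V Ω) := (innerSL ℝ h).comp embH

/-- `(u, v)_V = (∇u₁, ∇v₁)_{L²} + (∇u₂, ∇v₂)_{L²}`. -/
def innerV (u v : V Ω) : ℝ :=
  inner ℝ (H10.grad u.fst) (H10.grad v.fst) + inner ℝ (H10.grad u.snd) (H10.grad v.snd)

variable (Ω) in
/-- The constant `c_{VH}` of the embedding `V ⊂ H`: the least `c ≥ 0` with `‖u‖_H ≤ c ‖u‖_V`
for all `u ∈ V`. -/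
def embConst : ℝ :=
  sInf {c : ℝ | 0 ≤ c ∧ ∀ u : V Ω, ‖embH u‖ ≤ c * √(innerV u u)}

/-! ### The scalar product of `W` and the Riesz isomorphism `J_W` -/

/-- `(u, v)_W = (u, v)_V - l (u, v)_H`. -/
def innerW (l : ℝ) (u v : V Ω) : ℝ := innerV u v - l * inner ℝ (embH u) (embH v)

/-- The form `(u, v) ↦ (T u, T v)` on a Hilbert space. -/
def pullInner {X Y : Type*} [NormedAddCommGroup X] [InnerProductSpace ℝ X]
    [NormedAddCommGroup Y] [InnerProductSpace ℝ Y] (T : X →L[ℝ] Y) : X →L[ℝ] X →L[ℝ] ℝ :=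
  ((innerSL ℝ : Y →L[ℝ] Y →L[ℝ] ℝ)).bilinearComp T T

/-- The `W` scalar product as a bounded bilinear form on `V`. -/
def formW (l : ℝ) : V Ω →L[ℝ] V Ω →L[ℝ] ℝ :=
  pullInner (H10.grad.comp (WithLp.fstL 2 ℝ (H10 Ω) (H10 Ω)))
    + pullInner (H10.grad.comp (WithLp.sndL 2 ℝ (H10 Ω) (H10 Ω)))
    - l • pullInner (embH : V Ω →L[ℝ] H Ω)

theorem formW_apply (l : ℝ) (u v : V Ω) : formW l u v = innerW l u v := by
  rfl

theorem norm_sq_eq (u : V Ω) : ‖u‖ ^ 2 = ‖embH u‖ ^ 2 + innerV u u := by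
  have h1 : ‖embH u‖ ^ 2 = ‖H10.fn u.fst‖ ^ 2 + ‖H10.fn u.snd‖ ^ 2 := by
    rw [WithLp.prod_norm_sq_eq_of_L2]; rfl
  have h2 (w : H10 Ω) : ‖w‖ ^ 2 = ‖H10.fn w‖ ^ 2 + ‖H10.grad w‖ ^ 2 := by
    rw [← Submodule.norm_coe, WithLp.prod_norm_sq_eq_of_L2]; rfl
  rw [WithLp.prod_norm_sq_eq_of_L2, h1, h2, h2, innerV, real_inner_self_eq_norm_sq,
    real_inner_self_eq_norm_sq]
  ring

theorem innerV_self_nonneg (u : V Ω) : 0 ≤ innerV u u :=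
  add_nonneg real_inner_self_nonneg real_inner_self_nonneg

theorem isCoercive_formW {l : ℝ} (hl : l < 1 / embConst Ω ^ 2) :
    IsCoercive (formW l : V Ω →L[ℝ] V Ω →L[ℝ] ℝ) := by
  have key : ∃ C, 0 < C ∧ ∀ u : V Ω, C * ‖u‖ ^ 2 ≤ innerV u u - l * ‖embH u‖ ^ 2 := by
    rcases lt_or_ge l 0 with h | h
    · refine ⟨min 1 (-l), lt_min one_pos (by linarith), fun u => ?_⟩
      have a := mul_le_mul_of_nonneg_right (min_le_left 1 (-l)) (innerV_self_nonneg u)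
      have b := mul_le_mul_of_nonneg_right (min_le_right 1 (-l)) (sq_nonneg ‖embH u‖)
      rw [norm_sq_eq]; linarith
    · set S := {c : ℝ | 0 ≤ c ∧ ∀ u : V Ω, ‖embH u‖ ≤ c * √(innerV u u)} with hS
      have hc : embConst Ω = sInf S := rfl
      set c := embConst Ω with hcdef
      have hne : S.Nonempty := by
        by_contra hcon
        rw [Set.not_nonempty_iff_eq_empty] at hcon
        rw [hcon, Real.sInf_empty] at hc
        rw [hc] at hl; norm_num at hl; linarith
      have hcl : IsClosed S := by
        have : S = Set.Ici 0 ∩ ⋂ u : V Ω, {c | ‖embH u‖ ≤ c * √(innerV u u)} := by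
          ext; simp [hS]
        rw [this]
        exact isClosed_Ici.inter (isClosed_iInter fun u =>
          isClosed_le continuous_const (continuous_id.mul continuous_const))
      have hmem : c ∈ S := hc ▸ hcl.csInf_mem hne ⟨0, fun c hc => hc.1⟩
      have hcpos : 0 < c := by
        rcases hmem.1.lt_or_eq with h0 | h0
        · exact h0
        · rw [← h0] at hl; norm_num at hl; linarith
      have hlc : l * c ^ 2 < 1 := (lt_div_iff₀ (by positivity)).1 hl
      have hP (u : V Ω) : ‖embH u‖ ^ 2 ≤ c ^ 2 * innerV u u := by
        have := pow_le_pow_left₀ (norm_nonneg _) (hmem.2 u) 2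
        rwa [mul_pow, Real.sq_sqrt (innerV_self_nonneg u)] at this
      refine ⟨(1 - l * c ^ 2) / (1 + c ^ 2), div_pos (by linarith) (by positivity), fun u => ?_⟩
      have h3 : ‖u‖ ^ 2 ≤ (1 + c ^ 2) * innerV u u := by rw [norm_sq_eq]; linarith [hP u]
      calc (1 - l * c ^ 2) / (1 + c ^ 2) * ‖u‖ ^ 2
          ≤ (1 - l * c ^ 2) / (1 + c ^ 2) * ((1 + c ^ 2) * innerV u u) :=
            mul_le_mul_of_nonneg_left h3 (div_nonneg (by linarith) (by positivity))
        _ = innerV u u - l * (c ^ 2 * innerV u u) := by field_simp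
        _ ≤ _ := by linarith [mul_le_mul_of_nonneg_left (hP u) h]
  obtain ⟨C, hC, h⟩ := key
  refine ⟨C, hC, fun u => ?_⟩
  have := h u
  rw [formW_apply, innerW, real_inner_self_eq_norm_sq]
  linarith [pow_two ‖u‖, mul_assoc C ‖u‖ ‖u‖, congrArg (C * ·) (pow_two ‖u‖)]

/-- The canonical isomorphism `J_W : V* → V`, determined by `(J_W φ, v)_W = ⟨φ, v⟩`
for all `v ∈ V`; see `JW_spec` and `eq_JW`. -/
def JW {l : ℝ} (hl : l < 1 / embConst Ω ^ 2) (φ : StrongDual ℝ (V Ω)) : V Ω :=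
  (isCoercive_formW hl).continuousLinearEquivOfBilin.symm ((InnerProductSpace.toDual ℝ (V Ω)).symm φ)

theorem JW_spec {l : ℝ} (hl : l < 1 / embConst Ω ^ 2) (φ : StrongDual ℝ (V Ω)) (v : V Ω) :
    innerW l (JW hl φ) v = φ v := by
  rw [← formW_apply, ← (isCoercive_formW hl).continuousLinearEquivOfBilin_apply, JW,
    ContinuousLinearEquiv.apply_symm_apply, InnerProductSpace.toDual_symm_apply]

theorem eq_JW {l : ℝ} (hl : l < 1 / embConst Ω ^ 2) (φ : StrongDual ℝ (V Ω)) (w : V Ω)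
    (h : ∀ v, innerW l w v = φ v) : w = JW hl φ := by
  apply (isCoercive_formW hl).continuousLinearEquivOfBilin.injective
  refine ext_inner_right ℝ fun v => ?_
  rw [IsCoercive.continuousLinearEquivOfBilin_apply, IsCoercive.continuousLinearEquivOfBilin_apply,
    formW_apply, formW_apply, h, JW_spec]

/-! ### Multivalued mappings -/

/-- The support function `σ(v, A) = sup_{y ∈ A} (y, v)` for a given scalar product `(·, ·)`. -/
def supportFn {X : Type*} (ip : X → X → ℝ) (v : X) (A : Set X) : ℝ :=
  sSup ((fun y => ip y v) '' A)

/-- `f : Ω × ℝ² → CC(ℝ²)` is Caratheodory: `x ↦ f(x, s)` is (Lebesgue) measurable as a set-valued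
mapping for every `s` (preimages of open sets are measurable), and `s ↦ f(x, s)` is continuous
(in the Hausdorff metric, the metric of `ConvexBody`) for almost every `x ∈ Ω`. -/
def IsCaratheodory (Ω : Set (Euc d)) (f : Euc d → Euc 2 → ConvexBody (Euc 2)) : Prop :=
  (∀ s : Euc 2, ∀ O : Set (Euc 2), IsOpen O →
    NullMeasurableSet {x ∈ Ω | ((f x s : Set (Euc 2)) ∩ O).Nonempty} volume) ∧
  ∀ᵐ x ∂vol Ω, Continuous (f x)

/-- `f` is linearly bounded: `‖f(x, s)‖ = sup_{y ∈ f(x, s)} ‖y‖ ≤ α(x) + β ‖s‖` with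
`α ∈ L²(Ω)` and `β ≥ 0`. -/
def IsLinearlyBounded (Ω : Set (Euc d)) (f : Euc d → Euc 2 → ConvexBody (Euc 2)) : Prop :=
  ∃ α : Euc d → ℝ, MemLp α 2 (vol Ω) ∧ ∃ β : ℝ, 0 ≤ β ∧
    ∀ᵐ x ∂vol Ω, ∀ s : Euc 2, ∀ y ∈ f x s, ‖y‖ ≤ α x + β * ‖s‖

/-- The set-valued Nemytskii operator `N_f(u) = {h ∈ H : h(x) ∈ f(x, u(x)) for a.e. x ∈ Ω}`. -/
def nemytskii (f : Euc d → Euc 2 → ConvexBody (Euc 2)) (u : H Ω) : Set (H Ω) :=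
  {h | ∀ᵐ x ∂vol Ω, h.val x ∈ f x (u.val x)}

end EllipticInclusion

end

open EllipticInclusion

noncomputable section

open Filter Topology Metric

namespace MeasureTheory

variable {α : Type*} [MeasurableSpace α] {μ : Measure α}

/-! Since `JW` cancels against the `W` product, `(J_W h, v)_W = (h, v)_H = ∫ h·v`. The claim is thus
that supremum and integral may be interchanged over the selections `h ∈ N_f(u)`. The bound `≤` is
pointwise. For `≥`, near-maximizing selections must be measurable. Projecting `t v(x)` onto `f(x,
u(x))` gives a point of that set whose product with `v(x)` misses the supremum by at most `ρ(x)² /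
(2t)`, where `ρ = α + β‖u‖ ∈ L²`; let `t = n + 1 → ∞`. The projection is measurable in `x` because
it is the gradient of `z ↦ (‖z‖² - d(z, K)²) / 2`: its coordinates are limits of difference
quotients of distance functions, and distance is Caratheodory in `(s, z)`. -/

/-- A Caratheodory function (up to null sets) is superpositionally measurable. -/
theorem aemeasurable_comp_of_caratheodory {ι β : Type*}
    [TopologicalSpace ι] [TopologicalSpace.MetrizableSpace ι] [MeasurableSpace ι]
    [SecondCountableTopology ι] [OpensMeasurableSpace ι] [MeasurableSpace β] [TopologicalSpace β]
    [TopologicalSpace.PseudoMetrizableSpace β] [BorelSpace β] [Nonempty β]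
    [MeasurableSpace.CountablyGenerated β]
    {g : ι → α → β} (hc : ∀ᵐ x ∂μ, Continuous fun i => g i x) (hg : ∀ i, AEMeasurable (g i) μ)
    {u : α → ι} (hu : Measurable u) : AEMeasurable (fun x => g (u x) x) μ := by
  classical
  let b : β := Classical.arbitrary β
  -- Resetting `g` to a constant on the exceptional null set makes it continuous in `i` for every
  -- `x`.
  let G : ι → α → β := fun i x => if Continuous (fun i => g i x) then g i x else b
  have hG (i : ι) : G i =ᵐ[μ] g i := by
    filter_upwards [hc] with x hx
    simp [G, hx]
  have hGc (x : α) : Continuous fun i => G i x := by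
    by_cases h : Continuous fun i => g i x
    · simp only [G, h, if_true]
    · simp only [G, h, if_false, continuous_const]
  -- Over the completed σ-algebra each `G i` is genuinely measurable, so joint measurability
  -- applies.
  have hm : Measurable[NullMeasurableSpace.instMeasurableSpace (μ := μ)]
      (fun x : NullMeasurableSpace α μ => Function.uncurry G (u x, x)) := by
    have h1 : Measurable (Function.uncurry (α := ι) (β := NullMeasurableSpace α μ) G) :=
      measurable_uncurry_of_continuous_of_measurable hGc
        fun i => ((hg i).congr (hG i).symm).nullMeasurable.measurable'
    have h2 : Measurable (fun x : NullMeasurableSpace α μ => u x) :=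
      (Measurable.nullMeasurable (μ := μ) hu).measurable'
    exact h1.comp (h2.prodMk measurable_id)
  have hn : NullMeasurable (fun x => G (u x) x) μ := fun s hs => hm hs
  refine hn.aemeasurable.congr ?_
  filter_upwards [hc] with x hx
  simp [G, hx]

end MeasureTheory

namespace ConvexBody

/-! ### Metric projection onto a convex body as a gradient -/

section NearestPoint

variable {E : Type*} [NormedAddCommGroup E] [InnerProductSpace ℝ E]

theorem exists_nearest (K : ConvexBody E) (z : E) :
    ∃ y ∈ K, ∀ w ∈ K, inner ℝ (z - y) (w - y) ≤ 0 := by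
  obtain ⟨y, hy, h⟩ :=
    exists_norm_eq_iInf_of_complete_convex K.nonempty K.isCompact.isComplete K.convex z
  exact ⟨y, hy, (norm_eq_iInf_iff_real_inner_le_zero K.convex hy).1 h⟩

/-- The metric projection of `z` onto the convex body `K`. -/
def nearest (K : ConvexBody E) (z : E) : E := (K.exists_nearest z).choose

theorem nearest_mem (K : ConvexBody E) (z : E) : K.nearest z ∈ K :=
  (K.exists_nearest z).choose_spec.1

theorem inner_nearest_le_zero (K : ConvexBody E) (z : E) {w : E} (hw : w ∈ K) :
    inner ℝ (z - K.nearest z) (w - K.nearest z) ≤ 0 :=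
  (K.exists_nearest z).choose_spec.2 w hw

theorem infDist_eq_norm_sub_nearest (K : ConvexBody E) (z : E) :
    infDist z (K : Set E) = ‖z - K.nearest z‖ := by
  refine le_antisymm ?_ ((le_infDist K.nonempty).2 fun w hw => ?_)
  · rw [← dist_eq_norm]; exact infDist_le_dist_of_mem (K.nearest_mem z)
  · have h := K.inner_nearest_le_zero z hw
    have e : ‖z - w‖ ^ 2 = ‖z - K.nearest z‖ ^ 2
        - 2 * inner ℝ (z - K.nearest z) (w - K.nearest z) + ‖w - K.nearest z‖ ^ 2 := by
      rw [← norm_sub_sq_real, sub_sub_sub_cancel_right]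
    rw [dist_eq_norm]
    refine le_of_sq_le_sq ?_ (norm_nonneg _)
    nlinarith [sq_nonneg ‖w - K.nearest z‖]

/-- Adding the two variational inequalities gives `‖Pz - Pw‖² ≤ (z - w, Pz - Pw)`; then
Cauchy–Schwarz. -/
theorem norm_nearest_sub_le (K : ConvexBody E) (z w : E) :
    ‖K.nearest z - K.nearest w‖ ≤ ‖z - w‖ := by
  have h1 := K.inner_nearest_le_zero z (K.nearest_mem w)
  have h2 := K.inner_nearest_le_zero w (K.nearest_mem z)
  have e : ‖K.nearest z - K.nearest w‖ ^ 2 = inner ℝ (z - w) (K.nearest z - K.nearest w)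
      + inner ℝ (z - K.nearest z) (K.nearest w - K.nearest z)
      + inner ℝ (w - K.nearest w) (K.nearest z - K.nearest w) := by
    rw [← real_inner_self_eq_norm_sq]
    simp only [inner_sub_left, inner_sub_right]
    ring
  have h3 := real_inner_le_norm (z - w) (K.nearest z - K.nearest w)
  rcases (norm_nonneg (K.nearest z - K.nearest w)).eq_or_lt with h | h
  · rw [← h]; exact norm_nonneg _
  · nlinarith

/-- The function `z ↦ (‖z‖² - d(z, K)²) / 2`, whose gradient is the metric projection onto `K`. -/
def envelope (K : ConvexBody E) (z : E) : ℝ := (‖z‖ ^ 2 - infDist z (K : Set E) ^ 2) / 2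

theorem envelope_eq (K : ConvexBody E) (z : E) :
    K.envelope z = inner ℝ (K.nearest z) z - ‖K.nearest z‖ ^ 2 / 2 := by
  rw [envelope, infDist_eq_norm_sub_nearest, norm_sub_sq_real, real_inner_comm]
  ring

/-- Together with `envelope_eq`, this exhibits the envelope as a maximum of affine functions of `z`,
attained at the projection. -/
theorem inner_sub_le_envelope (K : ConvexBody E) (z : E) {w : E} (hw : w ∈ K) :
    inner ℝ w z - ‖w‖ ^ 2 / 2 ≤ K.envelope z := by
  have h : infDist z (K : Set E) ≤ ‖z - w‖ := by
    rw [← dist_eq_norm]; exact infDist_le_dist_of_mem hw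
  have h2 := pow_le_pow_left₀ infDist_nonneg h 2
  rw [norm_sub_sq_real, real_inner_comm] at h2
  rw [envelope]
  linarith

/-- The lower bound tests the maximum at `z + w` with the projection of `z`. The upper bound tests
the one at `z` with the projection of `z + w`, and nonexpansiveness makes the error quadratic. -/
theorem abs_envelope_sub_le (K : ConvexBody E) (z w : E) :
    |K.envelope (z + w) - K.envelope z - inner ℝ (K.nearest z) w| ≤ ‖w‖ ^ 2 := by
  have h1 := K.inner_sub_le_envelope (z + w) (K.nearest_mem z)
  have h2 := K.inner_sub_le_envelope z (K.nearest_mem (z + w))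
  have e1 := K.envelope_eq z
  have e2 := K.envelope_eq (z + w)
  have h3 := real_inner_le_norm (K.nearest (z + w) - K.nearest z) w
  have h4 := K.norm_nearest_sub_le (z + w) z
  rw [add_sub_cancel_left] at h4
  rw [inner_add_right] at h1 e2
  rw [inner_sub_left] at h3
  rw [abs_le]
  constructor <;> nlinarith [norm_nonneg w]

theorem tendsto_envelope_quotient (K : ConvexBody E) (z w : E) :
    Tendsto (fun n : ℕ => ((n : ℝ) + 1) *
      (K.envelope (z + (1 / ((n : ℝ) + 1)) • w) - K.envelope z)) atTop
      (𝓝 (inner ℝ (K.nearest z) w)) := by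
  rw [tendsto_iff_norm_sub_tendsto_zero]
  have h0 : Tendsto (fun n : ℕ => 1 / ((n : ℝ) + 1) * ‖w‖ ^ 2) atTop (𝓝 0) := by
    simpa using tendsto_one_div_add_atTop_nhds_zero_nat.mul_const (‖w‖ ^ 2)
  refine squeeze_zero (fun _ => norm_nonneg _) (fun n => ?_) h0
  have hn : (0 : ℝ) < (n : ℝ) + 1 := by positivity
  have h := K.abs_envelope_sub_le z ((1 / ((n : ℝ) + 1)) • w)
  rw [inner_smul_right, norm_smul, Real.norm_of_nonneg (by positivity)] at h
  have h2 := mul_le_mul_of_nonneg_left h hn.le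
  rw [← abs_of_pos hn, ← abs_mul, abs_of_pos hn] at h2
  rw [Real.norm_eq_abs]
  calc _ = _ := by congr 1; field_simp
    _ ≤ _ := h2
    _ = _ := by field_simp

/-- The projection of `t • p` onto `K` almost maximizes the scalar product with `p`. -/
theorem inner_le_inner_nearest_add (K : ConvexBody E) (p : E) {t R : ℝ} (ht : 0 < t)
    (hR : ∀ y ∈ K, ‖y‖ ≤ R) {y : E} (hy : y ∈ K) :
    inner ℝ y p ≤ inner ℝ (K.nearest (t • p)) p + R ^ 2 / (2 * t) := by
  -- For large `t` the linear term of the maximum at `t • p` dominates; the quadratic terms cost at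
  -- most `R² / 2` before division by `t`.
  have h1 := K.inner_sub_le_envelope (t • p) hy
  rw [envelope_eq, inner_smul_right, inner_smul_right] at h1
  have h2 := pow_le_pow_left₀ (norm_nonneg y) (hR y hy) 2
  have h3 := sq_nonneg ‖K.nearest (t • p)‖
  have h4 : t * (R ^ 2 / (2 * t)) = R ^ 2 / 2 := by field_simp
  refine le_of_mul_le_mul_left ?_ ht
  rw [mul_add, h4]
  linarith

theorem bddAbove_inner (K : ConvexBody E) (p : E) :
    BddAbove ((fun y => inner ℝ y p) '' (K : Set E)) :=
  K.isCompact.bddAbove_image (by fun_prop)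

theorem continuous_infDist : Continuous fun q : ConvexBody E × E => infDist q.2 (q.1 : Set E) := by
  -- Distance is 1-Lipschitz in the point and, for the Hausdorff metric, in the set; the max metric
  -- on the product gives 2.
  refine LipschitzWith.continuous (K := 2) (LipschitzWith.of_dist_le_mul fun q r => ?_)
  have hle (q r : ConvexBody E × E) :
      infDist q.2 (q.1 : Set E) ≤ infDist r.2 (r.1 : Set E) + 2 * dist q r := by
    have h1 : infDist q.2 (q.1 : Set E) ≤ infDist r.2 (q.1 : Set E) + dist q.2 r.2 :=
      infDist_le_infDist_add_dist
    have h2 : infDist r.2 (q.1 : Set E) ≤ infDist r.2 (r.1 : Set E) + dist q.1 r.1 := by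
      rw [dist_comm, ← hausdorffDist_coe]
      exact infDist_le_infDist_add_hausdorffDist hausdorffEDist_ne_top
    have h3 : dist q.1 r.1 ≤ dist q r := le_max_left _ _
    have h4 : dist q.2 r.2 ≤ dist q r := le_max_right _ _
    linarith
  have h1 := hle q r
  have h2 := hle r q
  rw [dist_comm r q] at h2
  rw [Real.dist_eq, abs_le]
  push_cast
  constructor <;> linarith

end NearestPoint

/-! ### Measurability of the projection -/

section Measurability

variable {α : Type*} [MeasurableSpace α] {μ : Measure α}

variable {n : ℕ}

theorem aemeasurable_nearest {F : α → ConvexBody (EuclideanSpace ℝ (Fin n))}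
    (hF : ∀ w : α → EuclideanSpace ℝ (Fin n), Measurable w →
      AEMeasurable (fun x => infDist (w x) (F x : Set (EuclideanSpace ℝ (Fin n)))) μ)
    {w : α → EuclideanSpace ℝ (Fin n)} (hw : Measurable w) :
    AEMeasurable (fun x => (F x).nearest (w x)) μ := by
  have henv (z : α → EuclideanSpace ℝ (Fin n)) (hz : Measurable z) :
      AEMeasurable (fun x => (F x).envelope (z x)) μ :=
    ((hz.norm.pow_const 2).aemeasurable.sub ((hF z hz).pow_const 2)).div_const 2
  have hcoord (i : Fin n) : AEMeasurable (fun x => (F x).nearest (w x) i) μ := by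
    have h := aemeasurable_of_tendsto_metrizable_ae' (μ := μ)
      (fun k : ℕ => ((henv (fun x => w x + (1 / ((k : ℝ) + 1)) • EuclideanSpace.single i (1 : ℝ))
        (hw.add_const _)).sub (henv w hw)).const_mul ((k : ℝ) + 1))
      (Eventually.of_forall fun x =>
        (F x).tendsto_envelope_quotient (w x) (EuclideanSpace.single i (1 : ℝ)))
    simpa [EuclideanSpace.inner_single_right] using h
  have : AEMeasurable (fun x i => (F x).nearest (w x) i) μ := aemeasurable_pi_lambda _ hcoord
  exact (MeasurableEquiv.toLp 2 (Fin n → ℝ)).measurable.comp_aemeasurable this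

end Measurability

end ConvexBody

/-! ### Almost optimal selections of the Nemytskii operator -/

namespace EllipticInclusion

variable {d : ℕ} {Ω : Set (Euc d)}

theorem H.measurable_val (h : H Ω) : Measurable h.val := by
  have h1 : Measurable (h.fst : Euc d → ℝ) := (Lp.stronglyMeasurable h.fst).measurable
  have h2 : Measurable (h.snd : Euc d → ℝ) := (Lp.stronglyMeasurable h.snd).measurable
  have : Measurable fun x => ![h.fst x, h.snd x] := by
    refine measurable_pi_lambda _ fun i => ?_
    fin_cases i
    · exact h1
    · exact h2
  exact (MeasurableEquiv.toLp 2 (Fin 2 → ℝ)).measurable.comp this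

theorem H.inner_val (h g : H Ω) (x : Euc d) :
    inner ℝ (h.val x) (g.val x) = inner ℝ (h.fst x) (g.fst x) + inner ℝ (h.snd x) (g.snd x) := by
  simp [H.val, PiLp.inner_apply, Fin.sum_univ_two]

theorem H.integrable_inner_val (h g : H Ω) :
    Integrable (fun x => (inner ℝ (h.val x) (g.val x) : ℝ)) (vol Ω) := by
  simp only [H.inner_val]
  exact (L2.integrable_inner h.fst g.fst).add (L2.integrable_inner h.snd g.snd)

theorem H.inner_eq_integral (h g : H Ω) :
    inner ℝ h g = ∫ x in Ω, (inner ℝ (h.val x) (g.val x) : ℝ) := by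
  simp only [H.inner_val]
  rw [integral_add (L2.integrable_inner h.fst g.fst) (L2.integrable_inner h.snd g.snd),
    WithLp.prod_inner_apply, ← L2.inner_def, ← L2.inner_def]
  rfl

theorem H.memLp_norm_val (h : H Ω) : MemLp (fun x => ‖h.val x‖) 2 (vol Ω) := by
  rw [memLp_two_iff_integrable_sq h.measurable_val.norm.aestronglyMeasurable]
  simp_rw [← real_inner_self_eq_norm_sq]
  exact h.integrable_inner_val h

/-- Every square integrable `ℝ²`-valued function is an element of `H`. -/
theorem H.exists_val_ae_eq {g : Euc d → Euc 2} (hg : MemLp g 2 (vol Ω)) :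
    ∃ h : H Ω, h.val =ᵐ[vol Ω] g := by
  have hc (i : Fin 2) : MemLp (fun x => g x i) 2 (vol Ω) :=
    (EuclideanSpace.proj (𝕜 := ℝ) i : Euc 2 →L[ℝ] ℝ).comp_memLp' hg
  refine ⟨WithLp.toLp 2 ((hc 0).toLp, (hc 1).toLp), ?_⟩
  filter_upwards [(hc 0).coeFn_toLp, (hc 1).coeFn_toLp] with x h0 h1
  ext i
  fin_cases i
  · exact h0
  · exact h1

theorem IsCaratheodory.aemeasurable_infDist {f : Euc d → Euc 2 → ConvexBody (Euc 2)}
    (hf : IsCaratheodory Ω f) (hΩ : MeasurableSet Ω) (s z : Euc 2) :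
    AEMeasurable (fun x => infDist z (f x s : Set (Euc 2))) (vol Ω) := by
  have h (r : ℝ) : NullMeasurableSet {x | infDist z (f x s : Set (Euc 2)) < r} (vol Ω) := by
    rw [nullMeasurableSet_restrict hΩ.nullMeasurableSet]
    -- The distance to `z` is below `r` exactly when the set meets the open ball, which is the form
    -- of measurability assumed.
    have e : {x | infDist z (f x s : Set (Euc 2)) < r} ∩ Ω =
        {x ∈ Ω | ((f x s : Set (Euc 2)) ∩ ball z r).Nonempty} := Set.ext fun x =>
      and_comm.trans (and_congr_right fun _ => by
        simp [infDist_lt_iff (f x s).nonempty, Set.Nonempty, dist_comm z])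
    exact e ▸ hf.1 s (ball z r) isOpen_ball
  have hm : Measurable fun x : NullMeasurableSpace (Euc d) (vol Ω) =>
      infDist z (f x s : Set (Euc 2)) := measurable_of_Iio fun r => h r
  exact NullMeasurable.aemeasurable fun t ht => hm ht

theorem IsCaratheodory.aemeasurable_nearest {f : Euc d → Euc 2 → ConvexBody (Euc 2)}
    (hf : IsCaratheodory Ω f) (hΩ : MeasurableSet Ω) {u w : Euc d → Euc 2}
    (hu : Measurable u) (hw : Measurable w) :
    AEMeasurable (fun x => (f x (u x)).nearest (w x)) (vol Ω) := by
  refine ConvexBody.aemeasurable_nearest (fun z hz => ?_) hw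
  have hc : ∀ᵐ x ∂vol Ω,
      Continuous fun q : Euc 2 × Euc 2 => infDist q.2 (f x q.1 : Set (Euc 2)) := by
    filter_upwards [hf.2] with x hx
    exact ConvexBody.continuous_infDist.comp ((hx.comp continuous_fst).prodMk continuous_snd)
  have hp : Measurable fun x => (u x, z x) := hu.prodMk hz
  have h := aemeasurable_comp_of_caratheodory
    (g := fun (q : Euc 2 × Euc 2) x => infDist q.2 (f x q.1 : Set (Euc 2))) hc
    (fun q => hf.aemeasurable_infDist hΩ q.1 q.2) hp
  exact h

theorem innerW_JW_embDual {l : ℝ} (hl : l < 1 / embConst Ω ^ 2) (h : H Ω) (v : V Ω) :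
    innerW l (JW hl (embDual h)) v =
      ∫ x in Ω, (inner ℝ (h.val x) ((embH v).val x) : ℝ) := by
  rw [JW_spec, ← H.inner_eq_integral]
  rfl

theorem inner_le_supportFn (K : ConvexBody (Euc 2)) (p : Euc 2) {y : Euc 2} (hy : y ∈ K) :
    inner ℝ y p ≤ supportFn (inner ℝ) p (K : Set (Euc 2)) :=
  le_csSup (K.bddAbove_inner p) ⟨y, hy, rfl⟩

theorem supportFn_le {K : ConvexBody (Euc 2)} {p : Euc 2} {c : ℝ}
    (h : ∀ y ∈ K, inner ℝ y p ≤ c) : supportFn (inner ℝ) p (K : Set (Euc 2)) ≤ c := by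
  refine csSup_le (K.nonempty.image _) ?_
  rintro _ ⟨y, hy, rfl⟩
  exact h y hy

/-- Almost optimal selections: for every `n` there is `h ∈ N_f(u)` whose pointwise scalar product
with `p` is within `ρ² / (2 (n + 1))` of the support function, where `ρ ∈ L²` is independent of
`n`. -/
theorem exists_nemytskii_supportFn_le {f : Euc d → Euc 2 → ConvexBody (Euc 2)}
    (hΩ : MeasurableSet Ω) (hf : IsCaratheodory Ω f) {u p : H Ω} {ρ : Euc d → ℝ}
    (hρ : MemLp ρ 2 (vol Ω)) (hb : ∀ᵐ x ∂vol Ω, ∀ y ∈ f x (u.val x), ‖y‖ ≤ ρ x) (n : ℕ) :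
    ∃ h ∈ nemytskii f u, ∀ᵐ x ∂vol Ω,
      supportFn (inner ℝ) (p.val x) (f x (u.val x) : Set (Euc 2)) ≤
        inner ℝ (h.val x) (p.val x) + ρ x ^ 2 * (1 / ((n : ℝ) + 1)) := by
  have hn : (0 : ℝ) < (n : ℝ) + 1 := by positivity
  have hm := hf.aemeasurable_nearest hΩ u.measurable_val
    (p.measurable_val.const_smul ((n : ℝ) + 1))
  have hL : MemLp (fun x => (f x (u.val x)).nearest (((n : ℝ) + 1) • p.val x)) 2 (vol Ω) := by
    refine hρ.mono hm.aestronglyMeasurable ?_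
    filter_upwards [hb] with x hx
    exact (hx _ (ConvexBody.nearest_mem _ _)).trans (le_abs_self _)
  obtain ⟨h, hh⟩ := H.exists_val_ae_eq hL
  refine ⟨h, ?_, ?_⟩
  · filter_upwards [hh] with x hx
    rw [hx]
    exact ConvexBody.nearest_mem _ _
  · filter_upwards [hh, hb] with x hx hbx
    rw [hx]
    refine supportFn_le fun y hy =>
      ((f x (u.val x)).inner_le_inner_nearest_add _ hn hbx hy).trans ?_
    -- The spare factor `1/2` in the error is given away here.
    gcongr
    rw [mul_one_div]
    gcongr
    linarith

end EllipticInclusion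

end

open EllipticInclusion
theorem lemma18 {d : ℕ} (Ω : Set (Euc d)) (hΩ_open : IsOpen Ω) (hΩ_conn : IsConnected Ω)
    (hΩ_bdd : Bornology.IsBounded Ω)
    (f : Euc d → Euc 2 → ConvexBody (Euc 2))
    (hf_car : IsCaratheodory Ω f) (hf_lin : IsLinearlyBounded Ω f)
    (l : ℝ) (hl : l < 1 / embConst Ω ^ 2) (u v : V Ω) :
    (nemytskii f (embH u)).Nonempty ∧
    BddAbove ((fun w => innerW l w v) '' ((fun h => JW hl (embDual h)) '' nemytskii f (embH u))) ∧
    MeasureTheory.Integrable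
      (fun x => supportFn (inner ℝ) ((embH v).val x) (f x ((embH u).val x) : Set (Euc 2)))
      (vol Ω) ∧
    supportFn (innerW l) v ((fun h => JW hl (embDual h)) '' nemytskii f (embH u)) =
      ∫ x in Ω, supportFn (inner ℝ) ((embH v).val x) (f x ((embH u).val x) : Set (Euc 2)) := by
  obtain ⟨α, hα, β, -, hαβ⟩ := hf_lin
  let ρ : Euc d → ℝ := fun x => α x + β * ‖(embH u).val x‖
  have hρ : MemLp ρ 2 (vol Ω) := hα.add ((embH u).memLp_norm_val.const_mul β)
  have hb : ∀ᵐ x ∂vol Ω, ∀ y ∈ f x ((embH u).val x), ‖y‖ ≤ ρ x := by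
    filter_upwards [hαβ] with x hx using hx _
  choose h hmem hle using
    exists_nemytskii_supportFn_le (p := embH v) hΩ_open.measurableSet hf_car hρ hb
  let σ : Euc d → ℝ := fun x =>
    supportFn (inner ℝ) ((embH v).val x) (f x ((embH u).val x) : Set (Euc 2))
  have hge {g : H Ω} (hg : g ∈ nemytskii f (embH u)) :
      ∀ᵐ x ∂vol Ω, inner ℝ (g.val x) ((embH v).val x) ≤ σ x := by
    filter_upwards [hg] with x hx using inner_le_supportFn _ _ hx
  -- The almost optimal selections squeeze `σ`, so it is an a.e. limit of measurable functions.
  have hσm : AEMeasurable σ (vol Ω) := by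
    refine aemeasurable_of_tendsto_metrizable_ae'
      (f := fun n x => (inner ℝ ((h n).val x) ((embH v).val x) : ℝ))
      (fun n => ((h n).integrable_inner_val (embH v)).aemeasurable) ?_
    filter_upwards [ae_all_iff.2 hle, ae_all_iff.2 fun n => hge (hmem n)] with x h1 h2
    have h0 : Filter.Tendsto (fun n : ℕ => σ x - ρ x ^ 2 * (1 / ((n : ℝ) + 1))) Filter.atTop (nhds (σ x)) := by
      simpa using (tendsto_one_div_add_atTop_nhds_zero_nat.const_mul (ρ x ^ 2)).const_sub (σ x)
    exact tendsto_of_tendsto_of_tendsto_of_le_of_le h0 tendsto_const_nhds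
      (fun n => sub_le_iff_le_add.2 (h1 n)) h2
  have hσi : Integrable σ (vol Ω) := by
    refine (hρ.integrable_mul (embH v).memLp_norm_val).mono' hσm.aestronglyMeasurable ?_
    filter_upwards [hb] with x hx
    have hK (y : Euc 2) (hy : y ∈ f x ((embH u).val x)) :
        |inner ℝ y ((embH v).val x)| ≤ ρ x * ‖(embH v).val x‖ :=
      (abs_real_inner_le_norm _ _).trans (mul_le_mul_of_nonneg_right (hx y hy) (norm_nonneg _))
    -- The lower bound on `σ` needs one point of the set; the upper bound uses all of them.
    obtain ⟨y, hy⟩ := (f x ((embH u).val x)).nonempty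
    exact abs_le.2 ⟨(abs_le.1 (hK y hy)).1.trans (inner_le_supportFn _ _ hy),
      supportFn_le fun y hy => (abs_le.1 (hK y hy)).2⟩
  have hub : ∀ c ∈ (fun w => innerW l w v) ''
      ((fun h => JW hl (embDual h)) '' nemytskii f (embH u)), c ≤ ∫ x in Ω, σ x := by
    rintro _ ⟨_, ⟨g, hg, rfl⟩, rfl⟩
    simp only [innerW_JW_embDual]
    exact integral_mono_ae (g.integrable_inner_val _) hσi (hge hg)
  have hbdd : BddAbove ((fun w => innerW l w v) ''
      ((fun h => JW hl (embDual h)) '' nemytskii f (embH u))) := ⟨_, hub⟩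
  have hne : (nemytskii f (embH u)).Nonempty := ⟨h 0, hmem 0⟩
  refine ⟨hne, hbdd, hσi, le_antisymm (csSup_le ((hne.image _).image _) hub) ?_⟩
  -- The integrated error `(∫ ρ²) / (n + 1)` vanishes because `ρ` does not depend on `n`.
  have hlim : Filter.Tendsto (fun n : ℕ => supportFn (innerW l) v
      ((fun h => JW hl (embDual h)) '' nemytskii f (embH u)) +
        (∫ x in Ω, ρ x ^ 2) * (1 / ((n : ℝ) + 1))) Filter.atTop (nhds (supportFn (innerW l) v
          ((fun h => JW hl (embDual h)) '' nemytskii f (embH u)))) := by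
    simpa using (tendsto_one_div_add_atTop_nhds_zero_nat.const_mul
      (∫ x in Ω, ρ x ^ 2)).const_add (supportFn (innerW l) v
        ((fun h => JW hl (embDual h)) '' nemytskii f (embH u)))
  refine ge_of_tendsto' hlim fun n => ?_
  have hi := (h n).integrable_inner_val (embH v)
  have hr : Integrable (fun x => ρ x ^ 2 * (1 / ((n : ℝ) + 1))) (vol Ω) :=
    hρ.integrable_sq.mul_const _
  calc ∫ x in Ω, σ x
      ≤ ∫ x in Ω, ((inner ℝ ((h n).val x) ((embH v).val x) : ℝ) + ρ x ^ 2 * (1 / ((n : ℝ) + 1))) :=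
        integral_mono_ae hσi (hi.add hr) (hle n)
    _ = innerW l (JW hl (embDual (h n))) v + (∫ x in Ω, ρ x ^ 2) * (1 / ((n : ℝ) + 1)) := by
        rw [integral_add hi hr, integral_mul_const, innerW_JW_embDual]
    _ ≤ _ := by
        gcongr
        exact le_csSup hbdd ⟨_, ⟨h n, hmem n, rfl⟩, rfl⟩
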